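/- Let $\mathcal S^n$ be the space of real symmetric $n\times n$ matrices, $S\bullet T=\sum_{i,j}s_{ij}t_{ij}$, and write $S\preceq T$ if $T-S$ is positive semidefinite. Given $A_1,\dots,A_m\in\mathcal S^n$ and $b\in\mathbb R^m$, consider the system $$(D)\qquad Y\succeq 0,\quad A_i\bullet Y=b_i\quad (i=1,\dots,m).$$ Call $(D)$ well-behaved if for every $B\in\mathcal S^n$ for which $v=\inf\{B\bullet Y : Y \text{ feasible in } (D)\}$ is finite there is $x\in\mathbb R^m$ with $\sum_i x_iA_i\preceq B$ and $\sum_i b_ix_i=v$; call it badly behaved otherwise. For an invertible $T\in\mathbb R^{n\times n}$ let $(D_T)$ be the system obtained from $(D)$ by replacing each $A_i$ by $T^{\mathsf T}A_iT$ and keeping $b$. Theorem. Let $0\le r\le n$ and suppose that $\bar Y=\begin{pmatrix} I_r&0\\0&0\end{pmatrix}$ is a feasible matrix of maximum rank in $(D)$. Then $(D)$ is badly behaved if and only if, after a suitable rotation, there is a certificate $V$; that is, if and only if there are an invertible matrix $T$ such that $\bar Y$ is also a feasible matrix of maximum rank in $(D_T)$, a matrix $V\in\mathcal S^n$ and a real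 number $\lambda$ with $$(T^{\mathsf T}A_iT)\bullet V=\lambda b_i\quad(i=1,\dots,m),\qquad V=\begin{pmatrix}V_{11}&e_1&V_{13}\\ e_1^{\mathsf T}&0&0\\ V_{13}^{\mathsf T}&0&V_{33}\end{pmatrix},$$ where the diagonal blocks have orders $r$, $1$ and $n-r-1$, $e_1\in\mathbb R^r$ is the first unit vector, $V_{11}$ and $V_{13}$ are arbitrary (with $V_{11}$ symmetric), and $V_{33}$ is positive semidefinite (possibly empty). In particular, such a $V$ can exist only if $1\le r\le n-1$. -/

import Mathlib

namespace DualSDP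

variable {n m : ℕ}

/-- The trace inner product `S • T = ∑ i j, s_ij t_ij`. -/
def dot (S T : Matrix (Fin n) (Fin n) ℝ) : ℝ := ∑ i, ∑ j, S i j * T i j

/-- The feasible set of the system `Y ⪰ 0`, `A_i • Y = b_i` for all `i`
(positive semidefiniteness includes symmetry). -/
def feasible (A : Fin m → Matrix (Fin n) (Fin n) ℝ) (b : Fin m → ℝ) :
    Set (Matrix (Fin n) (Fin n) ℝ) :=
  {Y | Y.PosSemidef ∧ ∀ i, dot (A i) Y = b i}

/-- `Y` is a feasible matrix of maximum rank. -/
def IsMaxRankFeasible (A : Fin m → Matrix (Fin n) (Fin n) ℝ) (b : Fin m → ℝ)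
    (Y : Matrix (Fin n) (Fin n) ℝ) : Prop :=
  Y ∈ feasible A b ∧ ∀ Y' ∈ feasible A b, Y'.rank ≤ Y.rank

/-- The system is well-behaved: for every symmetric objective `B` for which the infimum
`v` of `B • Y` over the feasible set is finite, there is `x` with `∑ x_i A_i ⪯ B` and
`∑ b_i x_i = v`. In `ℝ`, `IsGLB S v` forces `S` to be nonempty and bounded below. -/
def WellBehaved (A : Fin m → Matrix (Fin n) (Fin n) ℝ) (b : Fin m → ℝ) : Prop :=
  ∀ B : Matrix (Fin n) (Fin n) ℝ, B.IsSymm →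
    ∀ v : ℝ, IsGLB ((fun Y => dot B Y) '' feasible A b) v →
      ∃ x : Fin m → ℝ, (B - ∑ i, x i • A i).PosSemidef ∧ ∑ i, b i * x i = v

/-- The system is badly behaved. -/
def BadlyBehaved (A : Fin m → Matrix (Fin n) (Fin n) ℝ) (b : Fin m → ℝ) : Prop :=
  ¬ WellBehaved A b

/-- The `n × n` matrix `I_r ⊕ 0`. -/
def idZero (n r : ℕ) : Matrix (Fin n) (Fin n) ℝ :=
  Matrix.diagonal fun i => if i.val < r then 1 else 0

/-- The constraint matrices of the rotated system: `A_i` is replaced by `Tᵀ A_i T`. -/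
def rotate (T : Matrix (Fin n) (Fin n) ℝ) (A : Fin m → Matrix (Fin n) (Fin n) ℝ) :
    Fin m → Matrix (Fin n) (Fin n) ℝ :=
  fun i => T.transpose * A i * T

/-- `V` is symmetric, of the form
`[V₁₁, e₁, *; e₁ᵀ, 0, 0; *, 0, V₃₃]` with blocks of sizes `r`, `1`, `n - r - 1`,
where `V₃₃` is positive semidefinite (possibly empty). Rows are numbered from `0`, so
the middle block is the row and column with index `r`. -/
def HasSpecialForm (r : ℕ) (V : Matrix (Fin n) (Fin n) ℝ) : Prop :=
  V.IsSymm ∧ 0 < r ∧ ∃ hrn : r < n,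
    (∀ i : Fin n, i.val < r → V i ⟨r, hrn⟩ = if i.val = 0 then 1 else 0) ∧
    (∀ i : Fin n, r ≤ i.val → V i ⟨r, hrn⟩ = 0) ∧
    (V.submatrix (fun i : {i : Fin n // r < i.val} => i.val)
      (fun i : {i : Fin n // r < i.val} => i.val)).PosSemidef

end DualSDP

/-! Write J for the projection `idZero n r` and K = 1 - J. By maximality of the rank, every feasible
Y satisfies Y = JYJ. Duality on this face has a Slater point, so a finite value v always yields x
with b·x = v for which C = B - ∑ xᵢAᵢ has a positive semidefinite J-block. Bad behaviour means that
x cannot be corrected, within b·y = 0, to make all of C positive semidefinite.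

Two corrections suffice: one that matches the off-diagonal block of C and vanishes on the J-block
(`exists_offDiagonal_eq`), and one that vanishes on the range of J and dominates K on its complement
(`exists_sub_mem_quadCone`), a large multiple of which makes the K-block nonnegative. If either is
missing, separation gives V with Aᵢ • V = λbᵢ and KVK ⪰ 0. Either ker KVK contains a vector outside
ker JVK, which is a certificate, or a Schur complement makes V + kJ positive semidefinite; then KVK
≠ 0 would contradict maximality of the rank. Two Householder reflections commuting with J bring a
certificate to the special form, so an orthogonal T suffices there.

Conversely, given V in special form, take B with -1 at the two positions of e₁. Its value is 0, but
a dual optimal slack Z would live on the K-block, giving Z • V ≥ 0, whereas Z • V = B • V = -2. -/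

open Matrix

namespace DualSDP

/-! ### The trace inner product. -/

section Dot

variable {n m : ℕ}

theorem dot_eq_trace (S T : Matrix (Fin n) (Fin n) ℝ) : dot S T = (Sᵀ * T).trace := by
  simp only [dot, trace, diag_apply, mul_apply, transpose_apply]
  exact Finset.sum_comm

theorem dot_comm (S T : Matrix (Fin n) (Fin n) ℝ) : dot S T = dot T S := by
  simp [dot, mul_comm]

theorem dot_add_right (S T U : Matrix (Fin n) (Fin n) ℝ) :
    dot S (T + U) = dot S T + dot S U := by
  simp [dot_eq_trace, mul_add]

theorem dot_smul_right (c : ℝ) (S T : Matrix (Fin n) (Fin n) ℝ) :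
    dot S (c • T) = c * dot S T := by
  simp [dot_eq_trace]

theorem dot_sub_right (S T U : Matrix (Fin n) (Fin n) ℝ) :
    dot S (T - U) = dot S T - dot S U := by
  simp [dot_eq_trace, mul_sub]

/-- The trace inner product with a fixed matrix, as a linear functional. -/
def dotLin (S : Matrix (Fin n) (Fin n) ℝ) : Matrix (Fin n) (Fin n) ℝ →ₗ[ℝ] ℝ where
  toFun := dot S
  map_add' := dot_add_right S
  map_smul' c T := dot_smul_right c S T

@[simp] theorem dotLin_apply (S T : Matrix (Fin n) (Fin n) ℝ) : dotLin S T = dot S T := rfl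

theorem dot_add_left (S T U : Matrix (Fin n) (Fin n) ℝ) :
    dot (S + T) U = dot S U + dot T U := by
  simp [dot_comm _ U, dot_add_right]

theorem dot_sub_left (S T U : Matrix (Fin n) (Fin n) ℝ) :
    dot (S - T) U = dot S U - dot T U := by
  simp [dot_comm _ U, dot_sub_right]

theorem dot_sum_smul_left (x : Fin m → ℝ) (A : Fin m → Matrix (Fin n) (Fin n) ℝ)
    (T : Matrix (Fin n) (Fin n) ℝ) : dot (∑ i, x i • A i) T = ∑ i, x i * dot (A i) T := by
  rw [dot_comm, ← dotLin_apply, map_sum]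
  simp [dot_comm T]

theorem dot_transpose (S T : Matrix (Fin n) (Fin n) ℝ) : dot Sᵀ T = dot S Tᵀ := by
  simp only [dot, transpose_apply]
  exact Finset.sum_comm

theorem dot_mul_mul (P Q S T : Matrix (Fin n) (Fin n) ℝ) :
    dot (P * S * Q) T = dot S (Pᵀ * T * Qᵀ) := by
  rw [dot_eq_trace, dot_eq_trace, transpose_mul, transpose_mul, mul_assoc, trace_mul_comm]
  simp only [mul_assoc]

theorem dot_vecMulVec (S : Matrix (Fin n) (Fin n) ℝ) (v w : Fin n → ℝ) :
    dot S (vecMulVec v w) = v ⬝ᵥ S *ᵥ w := by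
  simp only [dot, vecMulVec_apply, dotProduct, mulVec, Finset.mul_sum]
  exact Finset.sum_congr rfl fun i _ => Finset.sum_congr rfl fun j _ => by ring

/-- Every linear functional on matrices is a trace inner product. -/
theorem exists_dot_eq (g : Matrix (Fin n) (Fin n) ℝ →ₗ[ℝ] ℝ) :
    ∃ W, ∀ X, g X = dot W X := by
  refine ⟨of fun i j => g (single i j 1), fun X => ?_⟩
  conv_lhs => rw [matrix_eq_sum_single X]
  simp only [map_sum, dot, of_apply]
  refine Finset.sum_congr rfl fun i _ => Finset.sum_congr rfl fun j _ => ?_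
  have : single i j (X i j) = X i j • single i j (1 : ℝ) := by simp [smul_single]
  rw [this, map_smul, smul_eq_mul, mul_comm]

end Dot

/-! ### Real positive semidefinite matrices. -/

section PosSemidef

variable {n m : ℕ}

theorem posSemidef_iff {M : Matrix (Fin n) (Fin n) ℝ} :
    M.PosSemidef ↔ M.IsSymm ∧ ∀ x : Fin n → ℝ, 0 ≤ x ⬝ᵥ M *ᵥ x := by
  simp [posSemidef_iff_dotProduct_mulVec, IsHermitian, IsSymm]

theorem posSemidef_conj {M : Matrix (Fin n) (Fin n) ℝ} (h : M.PosSemidef)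
    (P : Matrix (Fin n) (Fin n) ℝ) : (P * M * Pᵀ).PosSemidef := by
  simpa using h.mul_mul_conjTranspose_same P

theorem posSemidef_conj' {M : Matrix (Fin n) (Fin n) ℝ} (h : M.PosSemidef)
    (P : Matrix (Fin n) (Fin n) ℝ) : (Pᵀ * M * P).PosSemidef := by
  simpa using h.conjTranspose_mul_mul_same P

theorem posSemidef_mulVec_eq_zero {M : Matrix (Fin n) (Fin n) ℝ} (h : M.PosSemidef)
    {x : Fin n → ℝ} (hx : x ⬝ᵥ M *ᵥ x = 0) : M *ᵥ x = 0 :=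
  (h.dotProduct_mulVec_zero_iff x).1 (by simpa using hx)

theorem dot_nonneg {S T : Matrix (Fin n) (Fin n) ℝ} (hS : S.PosSemidef) (hT : T.PosSemidef) :
    0 ≤ dot S T := by
  obtain ⟨k, v, rfl⟩ := posSemidef_iff_eq_sum_vecMulVec.1 hT
  rw [← dotLin_apply, map_sum]
  refine Finset.sum_nonneg fun i _ => ?_
  rw [dotLin_apply, dot_vecMulVec]
  simpa using (posSemidef_iff.1 hS).2 (v i)

theorem ext_mulVec {M N : Matrix (Fin n) (Fin n) ℝ} (h : ∀ x, M *ᵥ x = N *ᵥ x) : M = N :=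
  Matrix.ext_of_mulVec_single fun _ => h _

theorem dotProduct_conj_mulVec (P M Q : Matrix (Fin n) (Fin n) ℝ) (x y : Fin n → ℝ) :
    x ⬝ᵥ (P * M * Q) *ᵥ y = (Pᵀ *ᵥ x) ⬝ᵥ M *ᵥ (Q *ᵥ y) := by
  rw [← mulVec_mulVec, ← mulVec_mulVec, dotProduct_mulVec, ← mulVec_transpose]

theorem isSymm_sum_smul {A : Fin m → Matrix (Fin n) (Fin n) ℝ} (hA : ∀ i, (A i).IsSymm)
    (x : Fin m → ℝ) : (∑ i, x i • A i).IsSymm := by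
  simp only [IsSymm, transpose_sum, transpose_smul, (hA _).eq]

/-- The identity is an order unit for the cone of matrices with nonnegative quadratic form. -/
theorem exists_quad_bound (X : Matrix (Fin n) (Fin n) ℝ) :
    ∃ k : ℝ, 0 ≤ k ∧ ∀ w : Fin n → ℝ, 0 ≤ w ⬝ᵥ X *ᵥ w + k * (w ⬝ᵥ w) := by
  refine ⟨∑ i, ∑ j, |X i j|, by positivity, fun w => ?_⟩
  have hw : ∀ i, w i ^ 2 ≤ w ⬝ᵥ w := fun i => by
    rw [dotProduct, sq]
    exact Finset.single_le_sum (f := fun i => w i * w i)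
      (fun j _ => mul_self_nonneg (w j)) (Finset.mem_univ i)
  rw [← dot_vecMulVec, dot, Finset.sum_mul, ← Finset.sum_add_distrib]
  refine Finset.sum_nonneg fun i _ => ?_
  rw [Finset.sum_mul, ← Finset.sum_add_distrib]
  refine Finset.sum_nonneg fun j _ => ?_
  rw [vecMulVec_apply]
  have h1 : |w i * w j| ≤ w ⬝ᵥ w := by
    rw [abs_le]
    constructor <;> nlinarith [hw i, hw j, sq_nonneg (w i + w j), sq_nonneg (w i - w j)]
  have h2 : |X i j * (w i * w j)| ≤ |X i j| * (w ⬝ᵥ w) := by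
    rw [abs_mul]; gcongr
  linarith [neg_abs_le (X i j * (w i * w j))]

theorem exists_add_smul_one_posSemidef {S : Matrix (Fin n) (Fin n) ℝ} (hS : S.IsSymm) :
    ∃ k : ℝ, 0 ≤ k ∧ (S + k • (1 : Matrix (Fin n) (Fin n) ℝ)).PosSemidef := by
  obtain ⟨k, hk, h⟩ := exists_quad_bound S
  refine ⟨k, hk, posSemidef_iff.2 ⟨?_, fun x => ?_⟩⟩
  · simp [IsSymm, hS.eq]
  · simpa [add_mulVec, smul_mulVec, dotProduct_add] using h x

/-- A section of `P` over its range, extended linearly to the whole space, is a generalized inverse.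
-/
theorem exists_mul_mul_self_eq (P : Matrix (Fin n) (Fin n) ℝ) :
    ∃ G : Matrix (Fin n) (Fin n) ℝ, P * G * P = P := by
  obtain ⟨s, hs⟩ := P.toLin'.rangeRestrict.exists_rightInverse_of_surjective
    (LinearMap.range_rangeRestrict _)
  obtain ⟨g, hg⟩ := s.exists_extend
  refine ⟨LinearMap.toMatrix' g, ext_mulVec fun x => ?_⟩
  have h1 : g (P *ᵥ x) = s ⟨P *ᵥ x, ⟨x, rfl⟩⟩ := LinearMap.congr_fun hg ⟨P *ᵥ x, ⟨x, rfl⟩⟩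
  have h2 := congrArg Subtype.val (LinearMap.congr_fun hs ⟨P *ᵥ x, ⟨x, rfl⟩⟩)
  rw [← mulVec_mulVec, ← mulVec_mulVec, LinearMap.toMatrix'_mulVec, h1]
  exact h2

/-- If `ker P ⊆ ker R` then `R` factors through `P`. -/
theorem exists_eq_mul_of_ker_le {P R : Matrix (Fin n) (Fin n) ℝ}
    (h : ∀ u, P *ᵥ u = 0 → R *ᵥ u = 0) : ∃ K, R = K * P := by
  obtain ⟨G, hG⟩ := exists_mul_mul_self_eq P
  refine ⟨R * G, ext_mulVec fun x => ?_⟩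
  have := h (x - (G * P) *ᵥ x) (by
    rw [mulVec_sub, mulVec_mulVec, ← mul_assoc, hG, sub_self])
  rw [mulVec_sub, sub_eq_zero, mulVec_mulVec, ← mul_assoc] at this
  exact this

end PosSemidef

/-! ### The minimal face containing the feasible set. -/

section MaxRank

variable {n m : ℕ} {A : Fin m → Matrix (Fin n) (Fin n) ℝ} {b : Fin m → ℝ}
  {J : Matrix (Fin n) (Fin n) ℝ}

/-- The midpoint of `Y` and `J` is feasible with kernel ker `Y` ∩ ker `J`; maximality of the rank
forces this to be all of ker `J`. -/
theorem ker_le_of_isMaxRankFeasible (hJ : IsMaxRankFeasible A b J)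
    {Y : Matrix (Fin n) (Fin n) ℝ} (hY : Y ∈ feasible A b) {x : Fin n → ℝ} (hx : J *ᵥ x = 0) :
    Y *ᵥ x = 0 := by
  obtain ⟨⟨hJ1, hJ2⟩, hmax⟩ := hJ
  obtain ⟨hY1, hY2⟩ := hY
  set Z := (1 / 2 : ℝ) • (Y + J) with hZ
  have hZf : Z ∈ feasible A b := by
    refine ⟨(hY1.add hJ1).smul (by norm_num), fun i => ?_⟩
    rw [hZ, dot_smul_right, dot_add_right, hY2, hJ2]; ring
  have hker : ∀ y : Fin n → ℝ, Z *ᵥ y = 0 → Y *ᵥ y = 0 ∧ J *ᵥ y = 0 := by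
    intro y hy
    have h1 := (posSemidef_iff.1 hY1).2 y
    have h2 := (posSemidef_iff.1 hJ1).2 y
    have h3 : y ⬝ᵥ Z *ᵥ y = 0 := by rw [hy, dotProduct_zero]
    rw [hZ, smul_mulVec, add_mulVec, dotProduct_smul, dotProduct_add, smul_eq_mul] at h3
    exact ⟨posSemidef_mulVec_eq_zero hY1 (by linarith),
      posSemidef_mulVec_eq_zero hJ1 (by linarith)⟩
  have hle : Z.mulVecLin.ker ≤ J.mulVecLin.ker := fun y hy => (hker y hy).2
  have e1 := LinearMap.finrank_range_add_finrank_ker Z.mulVecLin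
  have e2 := LinearMap.finrank_range_add_finrank_ker J.mulVecLin
  have e3 := hmax Z hZf
  simp only [Matrix.rank] at e3
  have heq := Submodule.eq_of_le_of_finrank_le hle (by omega)
  have : x ∈ Z.mulVecLin.ker := by rw [heq]; exact hx
  exact (hker x this).1

/-- Every feasible matrix lies in the face determined by a maximum rank projection. -/
theorem eq_conj_of_isMaxRankFeasible (hJ : IsMaxRankFeasible A b J) (hJs : Jᵀ = J)
    (hJJ : J * J = J) {Y : Matrix (Fin n) (Fin n) ℝ} (hY : Y ∈ feasible A b) :
    Y = J * Y * J := by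
  have h1 : Y * (1 - J) = 0 := ext_mulVec fun x => by
    rw [← mulVec_mulVec, zero_mulVec]
    refine ker_le_of_isMaxRankFeasible hJ hY ?_
    rw [mulVec_mulVec, mul_sub, mul_one, hJJ, sub_self, zero_mulVec]
  have h2 : Y = Y * J := by rwa [mul_sub, mul_one, sub_eq_zero] at h1
  have h3 : Y = J * Y := by
    have := congrArg transpose h2
    rwa [transpose_mul, hJs, (posSemidef_iff.1 hY.1).1.eq] at this
  rw [← h3, ← h2]

end MaxRank

/-! ### Conic duality and theorems of the alternative. -/

section Cones

variable {E : Type*} [AddCommGroup E] [Module ℝ E]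

/-- Conic duality under a Slater condition: a functional that is nonnegative on the part of a
cone cut out by finitely many linear equations is nonnegative on the whole cone after
subtracting a combination of these equations. -/
theorem exists_sum_mul_le_of_nonneg {ι : Type*} [Fintype ι] (C : PointedCone ℝ E)
    (φ : ι → E →ₗ[ℝ] ℝ) (ψ : E →ₗ[ℝ] ℝ) (x₀ : E) (h₀ : ∀ i, φ i x₀ = 0)
    (hu : ∀ y, ∃ c : ℝ, c • x₀ + y ∈ C) (hψ : ∀ y ∈ C, (∀ i, φ i y = 0) → 0 ≤ ψ y) :
    ∃ x : ι → ℝ, ∀ y ∈ C, ∑ i, x i * φ i y ≤ ψ y := by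
  have hmem : ∀ y, y ∈ (⨅ i, (φ i).ker) ↔ ∀ i, φ i y = 0 := fun y => by
    simp [Submodule.mem_iInf]
  obtain ⟨g, hg, hgC⟩ := riesz_extension C ⟨⨅ i, (φ i).ker, ψ.domRestrict _⟩
    (fun x hx => hψ x hx ((hmem _).1 x.2))
    (fun y => by
      obtain ⟨c, hc⟩ := hu y
      exact ⟨⟨c • x₀, (hmem _).2 fun i => by rw [map_smul, h₀, smul_zero]⟩, hc⟩)
  -- The extension `g` agrees with `ψ` on the common kernel, so the difference is a combination of
  -- the `φ i`.
  have hs : ψ - g ∈ Submodule.span ℝ (Set.range φ) := by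
    refine mem_span_of_iInf_ker_le_ker fun y hy => ?_
    have : g y = ψ y := hg ⟨y, hy⟩
    simp [this]
  obtain ⟨x, hx⟩ := (Submodule.mem_span_range_iff_exists_fun ℝ).1 hs
  refine ⟨x, fun y hy => ?_⟩
  have := LinearMap.congr_fun hx y
  simp only [LinearMap.sum_apply, LinearMap.smul_apply, smul_eq_mul, LinearMap.sub_apply] at this
  linarith [hgC y hy]

/-- Gordan's alternative: a subspace either contains an element dominating the order unit `e`, or
is annihilated by a nonnegative functional that is normalized at `e`. -/
theorem exists_sub_mem_or_exists_nonneg (C : PointedCone ℝ E) (M : Submodule ℝ E) (e : E)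
    (hu : ∀ y, ∃ c : ℝ, 0 ≤ c ∧ c • e + y ∈ C) :
    (∃ x ∈ M, x - e ∈ C) ∨
      ∃ g : E →ₗ[ℝ] ℝ, g e = 1 ∧ (∀ x ∈ M, g x = 0) ∧ ∀ y ∈ C, 0 ≤ g y := by
  by_cases h : ∃ x ∈ M, x - e ∈ C
  · exact Or.inl h
  right
  have he : e ∉ M := by
    intro he
    obtain ⟨c, -, hc⟩ := hu (-e + e)
    refine h ⟨(c + 1) • e, M.smul_mem _ he, ?_⟩
    convert hc using 1
    module
  -- Zero on `M` and one at `e`; a negative value on the cone would rescale to an element of `M`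
  -- dominating `e`.
  set f := LinearPMap.supSpanSingleton (⟨M, 0⟩ : E →ₗ.[ℝ] ℝ) e (1 : ℝ) he with hf
  have hdom : ∀ x ∈ M, ∀ c : ℝ, x + c • e ∈ f.domain := fun x hx c =>
    Submodule.add_mem_sup hx (Submodule.smul_mem _ _ (Submodule.mem_span_singleton_self e))
  have hval : ∀ x (hx : x ∈ M) (c : ℝ), f ⟨x + c • e, hdom x hx c⟩ = c := fun x hx c => by
    have := LinearPMap.supSpanSingleton_apply_mk (⟨M, 0⟩ : E →ₗ.[ℝ] ℝ) e (1 : ℝ) he x hx c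
    refine this.trans ?_
    simp
  obtain ⟨g, hg, hgC⟩ := riesz_extension C f
    (by
      rintro ⟨y, hy⟩ hyC
      obtain ⟨x, hx, z, hz, rfl⟩ := Submodule.mem_sup.1 hy
      obtain ⟨c, rfl⟩ := Submodule.mem_span_singleton.1 hz
      rw [hval x hx c]
      by_contra! hc
      refine h ⟨(-c)⁻¹ • x, M.smul_mem _ hx, ?_⟩
      have hc' : 0 ≤ (-c)⁻¹ := inv_nonneg.2 (by linarith)
      have : (-c)⁻¹ • (x + c • e) ∈ C := C.smul_mem hc' hyC
      convert this using 1
      rw [smul_add, smul_smul, inv_neg, neg_mul, inv_mul_cancel₀ hc.ne, neg_one_smul,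
        sub_eq_add_neg])
    (fun y => by
      obtain ⟨c, -, hc⟩ := hu y
      exact ⟨⟨0 + c • e, hdom 0 M.zero_mem c⟩, by simpa using hc⟩)
  refine ⟨g, ?_, fun x hx => ?_, hgC⟩
  · have := hg ⟨0 + (1 : ℝ) • e, hdom 0 M.zero_mem 1⟩
    rw [hval 0 M.zero_mem 1] at this
    simpa using this
  · have := hg ⟨x + (0 : ℝ) • e, hdom x hx 0⟩
    rw [hval x hx 0] at this
    simpa using this

/-- Matrices whose quadratic form is nonnegative on the range of `P`. -/
def quadCone {n : ℕ} (P : Matrix (Fin n) (Fin n) ℝ) :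
    PointedCone ℝ (Matrix (Fin n) (Fin n) ℝ) where
  carrier := {X | ∀ w : Fin n → ℝ, 0 ≤ (P *ᵥ w) ⬝ᵥ X *ᵥ (P *ᵥ w)}
  add_mem' {X Y} hX hY w := by
    rw [add_mulVec, dotProduct_add]
    exact add_nonneg (hX w) (hY w)
  zero_mem' w := by simp
  smul_mem' c X hX w := by
    have : c • X = (c : ℝ) • X := rfl
    rw [this, smul_mulVec, dotProduct_smul, smul_eq_mul]
    exact mul_nonneg c.2 (hX w)

theorem mem_quadCone {n : ℕ} {P X : Matrix (Fin n) (Fin n) ℝ} :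
    X ∈ quadCone P ↔ ∀ w : Fin n → ℝ, 0 ≤ (P *ᵥ w) ⬝ᵥ X *ᵥ (P *ᵥ w) := Iff.rfl

theorem exists_smul_add_mem_quadCone {n : ℕ} {P : Matrix (Fin n) (Fin n) ℝ}
    (hPP : P * P = P) (X : Matrix (Fin n) (Fin n) ℝ) :
    ∃ c : ℝ, 0 ≤ c ∧ c • P + X ∈ quadCone P := by
  obtain ⟨k, hk, h⟩ := exists_quad_bound X
  refine ⟨k, hk, fun w => ?_⟩
  have := h (P *ᵥ w)
  rw [add_mulVec, dotProduct_add, smul_mulVec, mulVec_mulVec, hPP, dotProduct_smul, smul_eq_mul]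
  linarith

/-- `quadCone` imposes no symmetry, so that separation can take place in the space of all matrices;
symmetrizing returns to positive semidefinite ones. -/
theorem posSemidef_symmPart_of_mem_quadCone {n : ℕ} {P X : Matrix (Fin n) (Fin n) ℝ}
    (hP : Pᵀ = P) (hX : X ∈ quadCone P) :
    (P * ((1 / 2 : ℝ) • (X + Xᵀ)) * P).PosSemidef := by
  refine posSemidef_iff.2 ⟨?_, fun w => ?_⟩
  · simp [IsSymm, transpose_mul, hP, add_comm, mul_assoc]
  · have h := hX w
    have h' : (P *ᵥ w) ⬝ᵥ Xᵀ *ᵥ (P *ᵥ w) = (P *ᵥ w) ⬝ᵥ X *ᵥ (P *ᵥ w) := by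
      rw [mulVec_transpose, dotProduct_comm, ← dotProduct_mulVec]
    rw [dotProduct_conj_mulVec, hP, smul_mulVec, add_mulVec, dotProduct_smul, dotProduct_add, h',
      smul_eq_mul]
    linarith

end Cones

/-! ### Strong duality on the minimal face. -/

section Slater

variable {n m : ℕ} {A : Fin m → Matrix (Fin n) (Fin n) ℝ} {b : Fin m → ℝ}
  {J : Matrix (Fin n) (Fin n) ℝ}

/-- A lower bound for the objective on the feasible set homogenizes. -/
theorem mul_le_dot_of_isGLB {B : Matrix (Fin n) (Fin n) ℝ} {v : ℝ}
    (hv : IsGLB ((fun Y => dot B Y) '' feasible A b) v) {Y : Matrix (Fin n) (Fin n) ℝ} {t : ℝ}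
    (hY : Y.PosSemidef) (hYt : ∀ i, dot (A i) Y = t * b i) : t * v ≤ dot B Y := by
  by_contra! hlt
  -- Since `t` may be negative, `s` copies of a nearly optimal feasible matrix are added to make the
  -- scale `t + s` positive.
  have hs : ∃ s : ℝ, 0 ≤ s ∧ 0 < t + s := ⟨max 0 (1 - t), le_max_left _ _, by
    linarith [le_max_right 0 (1 - t)]⟩
  obtain ⟨s, hs0, hs1⟩ := hs
  -- This makes the gap equal to ε(s + 1), more than the loss sε from near-optimality.
  set ε := (t * v - dot B Y) / (s + 1) with hε
  have hs2 : 0 < s + 1 := by linarith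
  have hε0 : 0 < ε := div_pos (by linarith) hs2
  obtain ⟨-, ⟨Y', hY', rfl⟩, -, hlt'⟩ := hv.exists_between (show v < v + ε by linarith)
  have hfeas : (t + s)⁻¹ • (Y + s • Y') ∈ feasible A b := by
    refine ⟨(hY.add (hY'.1.smul hs0)).smul (by positivity), fun i => ?_⟩
    rw [dot_smul_right, dot_add_right, dot_smul_right, hYt, hY'.2, ← add_mul, ← mul_assoc,
      inv_mul_cancel₀ hs1.ne', one_mul]
  have h := hv.1 ⟨_, hfeas, rfl⟩
  simp only [dot_smul_right, dot_add_right] at h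
  rw [inv_mul_eq_div, le_div_iff₀ hs1] at h
  have h1 : s * dot B Y' ≤ s * (v + ε) := mul_le_mul_of_nonneg_left hlt'.le hs0
  have h2 : ε * (s + 1) = t * v - dot B Y := div_mul_cancel₀ _ hs2.ne'
  nlinarith

/-- Strong duality relative to the minimal face of the feasible set. -/
theorem exists_eq_and_mem_quadCone_of_isGLB (hJ : IsMaxRankFeasible A b J) (hJs : Jᵀ = J)
    (hJJ : J * J = J) (hA : ∀ i, (A i).IsSymm) {B : Matrix (Fin n) (Fin n) ℝ} (hB : B.IsSymm)
    {v : ℝ} (hv : IsGLB ((fun Y => dot B Y) '' feasible A b) v) :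
    ∃ x : Fin m → ℝ, ∑ i, b i * x i = v ∧ B - ∑ i, x i • A i ∈ quadCone J := by
  have hdot : ∀ S X : Matrix (Fin n) (Fin n) ℝ, S.IsSymm →
      dot S (J * ((1 / 2 : ℝ) • (X + Xᵀ)) * J) = dot (J * S * J) X := by
    intro S X hS
    have h : (J * S * J)ᵀ = J * S * J := by simp [transpose_mul, hJs, hS.eq, mul_assoc]
    have h2 := dot_mul_mul J J S ((1 / 2 : ℝ) • (X + Xᵀ))
    rw [hJs] at h2
    rw [← h2, dot_smul_right, dot_add_right, ← dot_transpose, h]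
    ring
  have hJJJ : J * J * J = J := by rw [hJJ, hJJ]
  have hconj : ∀ S : Matrix (Fin n) (Fin n) ℝ, dot (J * S * J) J = dot S J := fun S => by
    rw [dot_mul_mul, hJs, hJJJ]
  -- Homogenized in (X, t) with t free: equations JAᵢJ • X = tbᵢ, objective JBJ • X - tv, Slater
  -- point (J, 1). Testing with (0, ±1) gives b·x = v; testing with (wwᵀ, 0) gives the cone
  -- membership.
  obtain ⟨x, hx⟩ := exists_sum_mul_le_of_nonneg
    (Submodule.prod (quadCone J) (⊤ : PointedCone ℝ ℝ))
    (fun i => (dotLin (J * A i * J)).coprod (LinearMap.lsmul ℝ ℝ (-b i)))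
    ((dotLin (J * B * J)).coprod (LinearMap.lsmul ℝ ℝ (-v))) (J, 1)
    (fun i => by simp [hconj, hJ.1.2 i])
    (fun y => by
      obtain ⟨c, -, hc⟩ := exists_smul_add_mem_quadCone hJJ y.1
      exact ⟨c, hc, trivial⟩)
    (by
      rintro ⟨Y, t⟩ ⟨hY, -⟩ hφ
      have := mul_le_dot_of_isGLB hv (t := t) (posSemidef_symmPart_of_mem_quadCone hJs hY)
        (fun i => by
          have := hφ i
          simp at this
          rw [hdot _ _ (hA i)]
          linarith)
      rw [hdot _ _ hB] at this
      simp
      linarith)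
  simp only [LinearMap.coprod_apply, dotLin_apply, LinearMap.lsmul_apply, smul_eq_mul] at hx
  refine ⟨x, ?_, fun w => ?_⟩
  · have h0 : ∀ S : Matrix (Fin n) (Fin n) ℝ, dot S 0 = 0 := fun S => map_zero (dotLin S)
    have h1 := hx (0, 1) ⟨Submodule.zero_mem _, trivial⟩
    have h2 := hx (0, -1) ⟨Submodule.zero_mem _, trivial⟩
    simp only [h0, zero_add, mul_neg, mul_one, neg_neg, Finset.sum_neg_distrib] at h1 h2
    simp only [mul_comm (b _)]
    linarith
  · have h1 := hx (vecMulVec w w, 0) ⟨fun z => by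
      rw [vecMulVec_mulVec, dotProduct_smul, op_smul_eq_smul, smul_eq_mul,
        dotProduct_comm w]
      exact mul_self_nonneg _, trivial⟩
    simp only [dot_vecMulVec, dotProduct_conj_mulVec, hJs, mul_zero, add_zero] at h1
    rw [sub_mulVec, dotProduct_sub, ← dot_vecMulVec (∑ i, x i • A i), dot_sum_smul_left]
    simp only [dot_vecMulVec]
    linarith

end Slater

/-! ### Certificates and well-behaved systems. -/

section Certificate

variable {n m : ℕ} {A : Fin m → Matrix (Fin n) (Fin n) ℝ} {b : Fin m → ℝ}
  {J : Matrix (Fin n) (Fin n) ℝ}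

/-- A coordinate-free certificate of bad behaviour: `V` is orthogonal to the constraints up to
`lam * b`, lies in the tangent cone of the positive semidefinite cone at the projection `J`,
and `u` witnesses that it is not a feasible direction. -/
structure IsCertificate (A : Fin m → Matrix (Fin n) (Fin n) ℝ) (b : Fin m → ℝ)
    (J V : Matrix (Fin n) (Fin n) ℝ) (lam : ℝ) (u : Fin n → ℝ) : Prop where
  symm : V.IsSymm
  dot_eq : ∀ i, dot (A i) V = lam * b i
  posSemidef : ((1 - J) * V * (1 - J)).PosSemidef
  mulVec_eq_zero : J *ᵥ u = 0
  compl_mulVec_eq_zero : (1 - J) *ᵥ (V *ᵥ u) = 0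
  mulVec_ne_zero : J *ᵥ (V *ᵥ u) ≠ 0

theorem dot_symmPart {S : Matrix (Fin n) (Fin n) ℝ} (hS : S.IsSymm)
    (V : Matrix (Fin n) (Fin n) ℝ) : dot S ((1 / 2 : ℝ) • (V + Vᵀ)) = dot S V := by
  rw [dot_smul_right, dot_add_right, ← dot_transpose, hS.eq]
  ring

theorem isSymm_symmPart (V : Matrix (Fin n) (Fin n) ℝ) :
    ((1 / 2 : ℝ) • (V + Vᵀ)).IsSymm := by
  simp [IsSymm, add_comm]

theorem mul_one_sub_self (hJJ : J * J = J) : J * (1 - J) = 0 := by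
  rw [mul_sub, mul_one, hJJ, sub_self]

theorem one_sub_mul_self (hJJ : J * J = J) : (1 - J) * J = 0 := by
  rw [sub_mul, one_mul, hJJ, sub_self]

theorem one_sub_mul_one_sub (hJJ : J * J = J) : (1 - J) * (1 - J) = 1 - J := by
  rw [sub_mul, one_mul, mul_one_sub_self hJJ, sub_zero]

theorem one_sub_transpose (hJs : Jᵀ = J) : (1 - J)ᵀ = 1 - J := by
  rw [transpose_sub, transpose_one, hJs]

/-- Without a certificate, the constraint combinations that vanish on the minimal face attain
every off-diagonal block. -/
theorem exists_offDiagonal_eq (hJs : Jᵀ = J) (hJJ : J * J = J) (hA : ∀ i, (A i).IsSymm)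
    (hno : ∀ V lam u, ¬ IsCertificate A b J V lam u) (C : Matrix (Fin n) (Fin n) ℝ) :
    ∃ y : Fin m → ℝ, ∑ i, b i * y i = 0 ∧ J * (∑ i, y i • A i) * J = 0 ∧
      J * (∑ i, y i • A i) * (1 - J) = J * C * (1 - J) := by
  set K := 1 - J with hK
  have hJK : J * K = 0 := mul_one_sub_self hJJ
  have hKJ : K * J = 0 := one_sub_mul_self hJJ
  have hKK : K * K = K := one_sub_mul_one_sub hJJ
  have hKs : Kᵀ = K := one_sub_transpose hJs
  clear_value K
  let S : (Fin m → ℝ) →ₗ[ℝ] Matrix (Fin n) (Fin n) ℝ := Fintype.linearCombination ℝ A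
  let β : (Fin m → ℝ) →ₗ[ℝ] ℝ := Fintype.linearCombination ℝ b
  let F : (Fin m → ℝ) →ₗ[ℝ] ℝ × Matrix (Fin n) (Fin n) ℝ × Matrix (Fin n) (Fin n) ℝ :=
    β.prod (((LinearMap.mulLeftRight ℝ (J, J)) ∘ₗ S).prod
      ((LinearMap.mulLeftRight ℝ (J, K)) ∘ₗ S))
  have hF : ∀ y, F y = (∑ i, y i * b i, J * (∑ i, y i • A i) * J, J * (∑ i, y i • A i) * K) :=
    fun y => rfl
  by_cases hmem : ((0 : ℝ), (0 : Matrix (Fin n) (Fin n) ℝ), J * C * K) ∈ LinearMap.range F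
  · obtain ⟨y, hy⟩ := hmem
    rw [hF] at hy
    simp only [Prod.mk.injEq] at hy
    exact ⟨y, by simpa only [mul_comm] using hy.1, hy.2.1, hy.2.2⟩
  exfalso
  -- The blocks representing a separating functional assemble to `V₀`, with zero K-block and nonzero
  -- off-diagonal block.
  obtain ⟨f, hf1, hf2⟩ := Submodule.exists_le_ker_of_notMem hmem
  obtain ⟨N, hN⟩ := exists_dot_eq
    (f ∘ₗ LinearMap.inr ℝ ℝ (Matrix (Fin n) (Fin n) ℝ × Matrix (Fin n) (Fin n) ℝ) ∘ₗ
      LinearMap.inl ℝ (Matrix (Fin n) (Fin n) ℝ) (Matrix (Fin n) (Fin n) ℝ))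
  obtain ⟨Q, hQ⟩ := exists_dot_eq
    (f ∘ₗ LinearMap.inr ℝ ℝ (Matrix (Fin n) (Fin n) ℝ × Matrix (Fin n) (Fin n) ℝ) ∘ₗ
      LinearMap.inr ℝ (Matrix (Fin n) (Fin n) ℝ) (Matrix (Fin n) (Fin n) ℝ))
  simp only [LinearMap.comp_apply, LinearMap.inr_apply, LinearMap.inl_apply] at hN hQ
  have hsplit : ∀ (t : ℝ) (X Z : Matrix (Fin n) (Fin n) ℝ),
      f (t, X, Z) = t * f (1, 0, 0) + dot N X + dot Q Z := by
    intro t X Z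
    rw [← hN, ← hQ, ← smul_eq_mul, ← map_smul, ← map_add, ← map_add]
    simp
  set V₀ : Matrix (Fin n) (Fin n) ℝ := J * N * J + J * Q * K with hV₀
  have hV₀A : ∀ i, dot (A i) V₀ = -f (1, 0, 0) * b i := by
    intro i
    have h : f (F (Pi.single i 1)) = 0 := hf2 ⟨_, rfl⟩
    have h1 : ∑ j, (Pi.single i 1 : Fin m → ℝ) j • A j = A i := by
      rw [Finset.sum_eq_single i] <;> simp +contextual
    have h2 : ∑ j, (Pi.single i 1 : Fin m → ℝ) j * b j = b i := by
      rw [Finset.sum_eq_single i] <;> simp +contextual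
    rw [hF, h1, h2, hsplit] at h
    rw [hV₀, dot_comm, dot_add_left, dot_mul_mul, dot_mul_mul, hJs, hKs]
    linarith
  have hQ0 : J * Q * K ≠ 0 := by
    intro h0
    rw [hsplit, dot_comm Q, dot_mul_mul, hJs, hKs, h0] at hf1
    simp [← dotLin_apply] at hf1
  obtain ⟨x, hx⟩ : ∃ x, (J * Q * K) *ᵥ x ≠ 0 := by
    by_contra! h
    exact hQ0 (ext_mulVec fun x => by rw [h, zero_mulVec])
  have hVK : ((1 / 2 : ℝ) • (V₀ + V₀ᵀ)) * K = (1 / 2 : ℝ) • (J * Q * K) := by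
    simp only [hV₀, transpose_add, transpose_mul, hJs, hKs, add_mul, smul_mul_assoc, mul_assoc,
      hJK, hKK, mul_zero, zero_add, add_zero]
  refine hno ((1 / 2 : ℝ) • (V₀ + V₀ᵀ)) (-f (1, 0, 0)) (K *ᵥ x)
    ⟨isSymm_symmPart V₀, fun i => ?_, ?_, ?_, ?_, ?_⟩
  · rw [dot_symmPart (hA i), hV₀A]
  · rw [← hK, mul_assoc, hVK, mul_smul_comm, ← mul_assoc, ← mul_assoc, hKJ]
    simpa using PosSemidef.zero
  · rw [mulVec_mulVec, hJK, zero_mulVec]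
  · rw [← hK, mulVec_mulVec, mulVec_mulVec, mul_assoc, hVK, mul_smul_comm, ← mul_assoc,
      ← mul_assoc, hKJ]
    simp
  · rw [mulVec_mulVec, mulVec_mulVec, mul_assoc, hVK, mul_smul_comm, ← mul_assoc, ← mul_assoc,
      hJJ, smul_mulVec]
    exact smul_ne_zero (by norm_num) hx

/-- A tangent direction whose off-diagonal block factors through its lower block is a feasible
direction, so by maximality of the rank its lower block vanishes. -/
theorem conj_one_sub_eq_zero_of_factor (hJ : IsMaxRankFeasible A b J) (hJs : Jᵀ = J)
    (hJJ : J * J = J) {V G : Matrix (Fin n) (Fin n) ℝ} {lam : ℝ} (hV : V.IsSymm)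
    (hVA : ∀ i, dot (A i) V = lam * b i) (hP : ((1 - J) * V * (1 - J)).PosSemidef)
    (hG : J * V * (1 - J) = G * ((1 - J) * V * (1 - J))) :
    (1 - J) * V * (1 - J) = 0 := by
  set K := 1 - J with hK
  have hJK : J * K = 0 := mul_one_sub_self hJJ
  have hKJ : K * J = 0 := one_sub_mul_self hJJ
  have hKs : Kᵀ = K := one_sub_transpose hJs
  clear_value K
  set P := K * V * K with hPdef
  have hPs : Pᵀ = P := (posSemidef_iff.1 hP).1
  -- Schur complement: G P Gᵀ is what the lower block `P` forces on the upper one, and `k` absorbs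
  -- the deficit.
  obtain ⟨k, hk, hkS⟩ := exists_add_smul_one_posSemidef (S := V - G * P * Gᵀ) (by
    simp [IsSymm, hV.eq, hPs, mul_assoc])
  have hdec : V + k • J = (1 + J * G) * P * (1 + J * G)ᵀ
      + J * (V - G * P * Gᵀ + k • 1) * Jᵀ := by
    have h1 : J * G * P = J * V * K := by
      rw [mul_assoc, ← hG, ← mul_assoc, ← mul_assoc, hJJ]
    have h2 : P * Gᵀ * J = K * V * J := by
      have := congrArg transpose h1
      simpa only [transpose_mul, hPs, hJs, hKs, hV.eq, mul_assoc] using this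
    have h3 : V = J * V * J + J * V * K + K * V * J + K * V * K := by
      rw [hK]; noncomm_ring
    have h4 : (1 + J * G) * P * (1 + J * G)ᵀ
        = P + J * G * P + P * Gᵀ * J + J * (G * P * Gᵀ) * J := by
      rw [transpose_add, transpose_one, transpose_mul, hJs]; noncomm_ring
    have h5 : J * (V - G * P * Gᵀ + k • 1) * Jᵀ
        = J * V * J - J * (G * P * Gᵀ) * J + k • J := by
      rw [hJs, mul_add, add_mul, mul_sub, sub_mul, mul_smul_comm, mul_one, smul_mul_assoc, hJJ]
    rw [h4, h5, h1, h2]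
    nth_rewrite 1 [h3]
    abel
  have hVk : (V + k • J).PosSemidef := by
    rw [hdec]
    exact (posSemidef_conj hP _).add (posSemidef_conj hkS _)
  -- The extra `|lam| + 1` copies of `J` keep the scale positive even if `lam` is negative.
  have hc : 0 < lam + k + (|lam| + 1) := by linarith [neg_abs_le lam]
  have hfeas : (lam + k + (|lam| + 1))⁻¹ • (V + k • J + (|lam| + 1) • J) ∈ feasible A b := by
    refine ⟨(hVk.add (hJ.1.1.smul (by positivity))).smul (by positivity), fun i => ?_⟩
    rw [dot_smul_right, dot_add_right, dot_add_right, dot_smul_right, dot_smul_right, hVA,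
      hJ.1.2, ← add_mul, ← add_mul, ← mul_assoc, inv_mul_cancel₀ hc.ne', one_mul]
  have h := eq_conj_of_isMaxRankFeasible hJ hJs hJJ hfeas
  have h' : K * ((lam + k + (|lam| + 1))⁻¹ • (V + k • J + (|lam| + 1) • J)) * K = 0 := by
    rw [h, ← mul_assoc, ← mul_assoc, hKJ]; simp
  rw [mul_smul_comm, smul_mul_assoc, smul_eq_zero, or_iff_right (inv_ne_zero hc.ne')] at h'
  simpa [mul_add, add_mul, hKJ] using h'

/-- Without a certificate, some constraint combination vanishing on the minimal face is positive
definite on its complement. -/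
theorem exists_sub_mem_quadCone (hJ : IsMaxRankFeasible A b J) (hJs : Jᵀ = J) (hJJ : J * J = J)
    (hA : ∀ i, (A i).IsSymm) (hno : ∀ V lam u, ¬ IsCertificate A b J V lam u) :
    ∃ y : Fin m → ℝ, ∑ i, b i * y i = 0 ∧ (∑ i, y i • A i) * J = 0 ∧
      (∑ i, y i • A i) - (1 - J) ∈ quadCone (1 - J) := by
  set K := 1 - J with hK
  have hJK : J * K = 0 := mul_one_sub_self hJJ
  have hKJ : K * J = 0 := one_sub_mul_self hJJ
  have hKK : K * K = K := one_sub_mul_one_sub hJJ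
  have hKs : Kᵀ = K := one_sub_transpose hJs
  clear_value K
  let S : (Fin m → ℝ) →ₗ[ℝ] Matrix (Fin n) (Fin n) ℝ := Fintype.linearCombination ℝ A
  let β : (Fin m → ℝ) →ₗ[ℝ] ℝ := Fintype.linearCombination ℝ b
  let F : (Fin m → ℝ) →ₗ[ℝ] ℝ × Matrix (Fin n) (Fin n) ℝ := β.prod ((LinearMap.mulRight ℝ J) ∘ₗ S)
  have hF : ∀ y, F y = (∑ i, y i * b i, (∑ i, y i • A i) * J) := fun y => rfl
  rcases exists_sub_mem_or_exists_nonneg (quadCone K) ((LinearMap.ker F).map S) K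
    (exists_smul_add_mem_quadCone hKK) with ⟨_, ⟨y, hy, rfl⟩, hmem⟩ | ⟨g, hg1, hg0, hgC⟩
  · have hy' : F y = 0 := hy
    rw [hF, Prod.mk_eq_zero] at hy'
    exact ⟨y, by simpa only [mul_comm] using hy'.1, hy'.2, hmem⟩
  exfalso
  -- `g ∘ S` vanishes on ker `F`, so it factors through `F`; the factor supplies the multiplier `h
  -- (1, 0)` and a term `N * J` invisible in the K-block.
  have hgS : g ∘ₗ S ∈ LinearMap.range F.dualMap := by
    rw [LinearMap.range_dualMap_eq_dualAnnihilator_ker, Submodule.mem_dualAnnihilator]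
    exact fun y hy => hg0 _ ⟨y, hy, rfl⟩
  obtain ⟨h, hh⟩ := hgS
  obtain ⟨W, hW⟩ := exists_dot_eq g
  obtain ⟨N, hN⟩ := exists_dot_eq (h ∘ₗ LinearMap.inr ℝ ℝ (Matrix (Fin n) (Fin n) ℝ))
  simp only [LinearMap.comp_apply, LinearMap.inr_apply] at hN
  have hsplit : ∀ (t : ℝ) (X : Matrix (Fin n) (Fin n) ℝ), h (t, X) = t * h (1, 0) + dot N X := by
    intro t X
    rw [← hN, ← smul_eq_mul, ← map_smul, ← map_add]
    simp
  have hNJ : ∀ X : Matrix (Fin n) (Fin n) ℝ, dot (N * J) X = dot N (X * J) := fun X => by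
    simpa [hJs] using dot_mul_mul 1 J N X
  have hV₀A : ∀ i, dot (A i) (W - N * J) = h (1, 0) * b i := by
    intro i
    have h0 : h (F (Pi.single i 1)) = g (S (Pi.single i 1)) :=
      LinearMap.congr_fun hh (Pi.single i 1)
    have h1 : ∑ j, (Pi.single i 1 : Fin m → ℝ) j • A j = A i := by
      rw [Finset.sum_eq_single i] <;> simp +contextual
    have h2 : ∑ j, (Pi.single i 1 : Fin m → ℝ) j * b j = b i := by
      rw [Finset.sum_eq_single i] <;> simp +contextual
    have h3 : S (Pi.single i 1) = A i := h1
    rw [h3, hF, h1, h2, hsplit, hW] at h0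
    rw [dot_comm, dot_sub_left, hNJ]
    linarith
  set V : Matrix (Fin n) (Fin n) ℝ := (1 / 2 : ℝ) • ((W - N * J) + (W - N * J)ᵀ) with hV
  have hVs : V.IsSymm := isSymm_symmPart _
  have hVA : ∀ i, dot (A i) V = h (1, 0) * b i := fun i => by
    rw [hV, dot_symmPart (hA i), hV₀A]
  have hKVK : K * V * K = K * ((1 / 2 : ℝ) • (W + Wᵀ)) * K := by
    simp only [hV, transpose_sub, transpose_mul, hJs, add_mul, mul_add, smul_mul_assoc,
      mul_smul_comm, sub_mul, mul_sub, mul_assoc, hJK, mul_zero, sub_zero]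
    rw [← mul_assoc K J, hKJ, zero_mul, sub_zero]
  have hWC : W ∈ quadCone K := fun w => by
    have := hgC (vecMulVec (K *ᵥ w) (K *ᵥ w)) fun z => by
      rw [vecMulVec_mulVec, dotProduct_smul, op_smul_eq_smul, smul_eq_mul,
        dotProduct_comm (K *ᵥ w)]
      exact mul_self_nonneg _
    rwa [hW, dot_vecMulVec] at this
  have hP : (K * V * K).PosSemidef := by
    rw [hKVK]
    exact posSemidef_symmPart_of_mem_quadCone hKs hWC
  -- V • K = g(K) = 1, so the K-block has trace one.
  have hne : K * V * K ≠ 0 := by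
    intro h0
    have h1 : dot V K = 1 := by
      have hKsymm : K.IsSymm := hKs
      rw [dot_comm, hV, dot_symmPart hKsymm, dot_comm, dot_sub_left, hNJ, hKJ, ← hW, hg1]
      simp [← dotLin_apply]
    have h2 := dot_mul_mul K K V 1
    rw [h0, hKs, mul_one, hKK, h1, dot_comm] at h2
    simp [← dotLin_apply] at h2
  by_cases hker : ∀ u, (K * V * K) *ᵥ u = 0 → (J * V * K) *ᵥ u = 0
  · obtain ⟨G, hG⟩ := exists_eq_mul_of_ker_le hker
    rw [hK] at hP hG hne
    exact hne (conj_one_sub_eq_zero_of_factor hJ hJs hJJ hVs hVA hP hG)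
  · push Not at hker
    obtain ⟨u, hu1, hu2⟩ := hker
    refine hno V (h (1, 0)) (K *ᵥ u) ⟨hVs, hVA, hK ▸ hP, ?_, ?_, ?_⟩
    · rw [mulVec_mulVec, hJK, zero_mulVec]
    · rwa [← hK, mulVec_mulVec, mulVec_mulVec]
    · rwa [mulVec_mulVec, mulVec_mulVec]

theorem wellBehaved_of_forall_not_isCertificate (hJ : IsMaxRankFeasible A b J) (hJs : Jᵀ = J)
    (hJJ : J * J = J) (hA : ∀ i, (A i).IsSymm)
    (hno : ∀ V lam u, ¬ IsCertificate A b J V lam u) : WellBehaved A b := by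
  intro B hB v hv
  obtain ⟨x, hx, hC⟩ := exists_eq_and_mem_quadCone_of_isGLB hJ hJs hJJ hA hB hv
  set C := B - ∑ i, x i • A i with hCdef
  obtain ⟨y, hy0, hyJ, hyK⟩ := exists_sub_mem_quadCone hJ hJs hJJ hA hno
  obtain ⟨z, hz0, hzJ, hzK⟩ := exists_offDiagonal_eq hJs hJJ hA hno C
  set La := ∑ i, y i • A i with hLa
  set Lb := ∑ i, z i • A i with hLb
  set K := 1 - J with hK
  have hKs : Kᵀ = K := one_sub_transpose hJs
  have hKK : K * K = K := one_sub_mul_one_sub hJJ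
  clear_value K
  have hLas : La.IsSymm := isSymm_sum_smul hA y
  have hLbs : Lb.IsSymm := isSymm_sum_smul hA z
  have hCs : C.IsSymm := hB.sub (isSymm_sum_smul hA x)
  -- On the range of `K`, `La` dominates the identity, so `k • La` outweighs the negative part of `C
  -- - Lb`.
  obtain ⟨k, hk, hkb⟩ := exists_quad_bound (C - Lb)
  have hsum : B - ∑ i, (x i + z i - k * y i) • A i = C - Lb + k • La := by
    simp only [add_smul, sub_smul, mul_smul, Finset.sum_add_distrib, Finset.sum_sub_distrib,
      ← Finset.smul_sum, hCdef, hLa, hLb]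
    abel
  have hJLa : J * La = 0 := by
    have := congrArg transpose hyJ
    rwa [transpose_mul, hJs, hLas.eq, transpose_zero] at this
  have hKzJ : K * Lb * J = K * C * J := by
    have := congrArg transpose hzK
    simpa only [transpose_mul, hJs, hKs, hLbs.eq, hCs.eq, mul_assoc] using this
  have hdec : C - Lb + k • La = J * C * J + K * (C - Lb + k • La) * K := by
    set D := C - Lb + k • La with hD
    have h1 : D = J * D * J + J * D * K + K * D * J + K * D * K := by
      rw [hK]; noncomm_ring
    have h2 : J * D * J = J * C * J := by
      rw [hD, mul_add, mul_sub, mul_smul_comm, hJLa, smul_zero, add_zero, sub_mul, hzJ, sub_zero]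
    have h3 : J * D * K = 0 := by
      rw [hD, mul_add, mul_sub, mul_smul_comm, hJLa, smul_zero, add_zero, sub_mul, hzK, sub_self]
    have h4 : K * D * J = 0 := by
      rw [hD, mul_add, mul_sub, mul_smul_comm, add_mul, sub_mul, hKzJ, sub_self, smul_mul_assoc,
        mul_assoc, hyJ, mul_zero, smul_zero, add_zero]
    nth_rewrite 1 [h1]
    rw [h2, h3, h4, add_zero, add_zero]
  refine ⟨fun i => x i + z i - k * y i, ?_, ?_⟩
  · rw [hsum]
    refine posSemidef_iff.2 ⟨(hCs.sub hLbs).add (hLas.smul k), fun w => ?_⟩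
    rw [hdec, add_mulVec, dotProduct_add, dotProduct_conj_mulVec, dotProduct_conj_mulVec, hJs, hKs]
    have h1 := hC w
    have h2 := hkb (K *ᵥ w)
    have h3 := hyK w
    rw [sub_mulVec, dotProduct_sub, mulVec_mulVec w K K, hKK] at h3
    rw [add_mulVec, dotProduct_add, smul_mulVec, dotProduct_smul, smul_eq_mul]
    nlinarith
  · have : ∑ i, b i * (x i + z i - k * y i)
        = ∑ i, b i * x i + ∑ i, b i * z i - k * ∑ i, b i * y i := by
      rw [Finset.mul_sum, ← Finset.sum_add_distrib, ← Finset.sum_sub_distrib]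
      exact Finset.sum_congr rfl fun i _ => by ring
    rw [this, hx, hz0, hy0]
    ring

end Certificate

/-! ### Congruence of systems, and reflections. -/

section Rotation

variable {n m : ℕ} {A : Fin m → Matrix (Fin n) (Fin n) ℝ} {b : Fin m → ℝ}

theorem dot_rotate (T : Matrix (Fin n) (Fin n) ℝ) (i : Fin m) (X : Matrix (Fin n) (Fin n) ℝ) :
    dot (rotate T A i) X = dot (A i) (T * X * Tᵀ) := by
  rw [rotate, dot_mul_mul, transpose_transpose]

theorem mem_feasible_of_rotate {T Y : Matrix (Fin n) (Fin n) ℝ}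
    (hY : Y ∈ feasible (rotate T A) b) : T * Y * Tᵀ ∈ feasible A b :=
  ⟨posSemidef_conj hY.1 T, fun i => by rw [← dot_rotate, hY.2]⟩

theorem rotate_mem_feasible {T U Y : Matrix (Fin n) (Fin n) ℝ} (hTU : T * U = 1)
    (hY : Y ∈ feasible A b) : U * Y * Uᵀ ∈ feasible (rotate T A) b := by
  refine ⟨posSemidef_conj hY.1 U, fun i => ?_⟩
  have : T * (U * Y * Uᵀ) * Tᵀ = (T * U) * Y * (T * U)ᵀ := by
    rw [transpose_mul]; simp only [mul_assoc]
  rw [dot_rotate, this, hTU]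
  simpa using hY.2 i

/-- Being well-behaved is invariant under rotation. -/
theorem WellBehaved.rotate {T : Matrix (Fin n) (Fin n) ℝ} (hT : IsUnit T)
    (h : WellBehaved A b) : WellBehaved (rotate T A) b := by
  intro B hB v hv
  obtain ⟨⟨_, U, hTU, hUT⟩, rfl⟩ := hT
  simp only at hv ⊢
  rename_i T
  -- With U = T⁻¹, the objective B of the rotated system corresponds to UᵀBU.
  have himg : (fun Y => dot (Uᵀ * B * U) Y) '' feasible A b
      = (fun Y => dot B Y) '' feasible (DualSDP.rotate T A) b := by
    ext t
    constructor
    · rintro ⟨Y, hY, rfl⟩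
      exact ⟨U * Y * Uᵀ, rotate_mem_feasible hTU hY, by simp [dot_mul_mul]⟩
    · rintro ⟨Y, hY, rfl⟩
      refine ⟨T * Y * Tᵀ, mem_feasible_of_rotate hY, ?_⟩
      have : U * (T * Y * Tᵀ) * Uᵀ = (U * T) * Y * (U * T)ᵀ := by
        rw [transpose_mul]; simp only [mul_assoc]
      simp [dot_mul_mul, this, hUT]
  rw [← himg] at hv
  obtain ⟨x, hx, hxv⟩ := h (Uᵀ * B * U) (by
    simp [IsSymm, transpose_mul, hB.eq, mul_assoc]) v hv
  refine ⟨x, ?_, hxv⟩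
  convert posSemidef_conj' hx T using 1
  have h1 : Tᵀ * (Uᵀ * B * U) * T = B := by
    have : Tᵀ * (Uᵀ * B * U) * T = (U * T)ᵀ * B * (U * T) := by
      rw [transpose_mul]; simp only [mul_assoc]
    rw [this, hUT]; simp
  rw [mul_sub, sub_mul, h1, Finset.mul_sum, Finset.sum_mul]
  simp [DualSDP.rotate]

theorem isMaxRankFeasible_rotate {T J : Matrix (Fin n) (Fin n) ℝ} (hTT : T * Tᵀ = 1)
    (hTJ : T * J = J * T) (hJ : IsMaxRankFeasible A b J) :
    IsMaxRankFeasible (rotate T A) b J := by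
  have hTT' : Tᵀ * T = 1 := mul_eq_one_comm.1 hTT
  refine ⟨?_, fun Y hY => ?_⟩
  · have := rotate_mem_feasible hTT hJ.1
    rwa [transpose_transpose, mul_assoc, ← hTJ, ← mul_assoc, hTT', one_mul] at this
  · refine le_trans (le_of_eq ?_) (hJ.2 _ (mem_feasible_of_rotate hY))
    have hdet : IsUnit T.det := (isUnit_iff_isUnit_det T).1 ⟨⟨T, Tᵀ, hTT, hTT'⟩, rfl⟩
    have hdet' : IsUnit Tᵀ.det := by rwa [det_transpose]
    rw [rank_mul_eq_left_of_isUnit_det _ _ hdet', rank_mul_eq_right_of_isUnit_det _ _ hdet]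

/-- The Householder reflection exchanging two unit vectors. -/
theorem exists_householder {p q : Fin n → ℝ} (hp : p ⬝ᵥ p = 1) (hq : q ⬝ᵥ q = 1) :
    ∃ H : Matrix (Fin n) (Fin n) ℝ, Hᵀ = H ∧ H * H = 1 ∧ H *ᵥ q = p ∧
      (∀ w, p ⬝ᵥ w = 0 → q ⬝ᵥ w = 0 → H *ᵥ w = w) ∧
      ∀ P : Matrix (Fin n) (Fin n) ℝ, Pᵀ = P → ∀ a : ℝ, P *ᵥ p = a • p → P *ᵥ q = a • q →
        H * P = P * H := by
  set h := p - q with hh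
  -- If p = q, division by zero gives c = 0 and the reflection degenerates to the identity.
  set c := 2 / (h ⬝ᵥ h) with hc
  have hhh : h ⬝ᵥ h = 2 - 2 * (p ⬝ᵥ q) := by
    rw [hh, sub_dotProduct, dotProduct_sub, dotProduct_sub, hp, hq, dotProduct_comm q p]; ring
  have hhq : h ⬝ᵥ q = p ⬝ᵥ q - 1 := by rw [hh, sub_dotProduct, hq]
  have hmul : ∀ w, (1 - c • vecMulVec h h) *ᵥ w = w - (c * (h ⬝ᵥ w)) • h := fun w => by
    rw [sub_mulVec, one_mulVec, smul_mulVec, vecMulVec_mulVec, op_smul_eq_smul, smul_smul]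
  refine ⟨1 - c • vecMulVec h h, ?_, ?_, ?_, ?_, ?_⟩
  · rw [transpose_sub, transpose_one, transpose_smul, transpose_vecMulVec]
  · refine ext_mulVec fun w => ?_
    rw [← mulVec_mulVec, hmul, hmul, dotProduct_sub, dotProduct_smul, one_mulVec, smul_eq_mul]
    have : c * (c * (h ⬝ᵥ h)) = 2 * c := by
      by_cases h0 : h ⬝ᵥ h = 0
      · simp [hc, h0]
      · rw [hc, div_mul_cancel₀ _ h0]; ring
    rw [sub_sub, ← add_smul]
    have h2 : c * (h ⬝ᵥ w) + c * (h ⬝ᵥ w - c * (h ⬝ᵥ w) * (h ⬝ᵥ h)) = 0 := by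
      linear_combination (-(h ⬝ᵥ w)) * this
    rw [h2, zero_smul, sub_zero]
  · rw [hmul]
    by_cases h0 : h ⬝ᵥ h = 0
    · have : h = 0 := dotProduct_self_eq_zero.1 h0
      have hpq : p = q := sub_eq_zero.1 this
      rw [this, smul_zero, sub_zero, hpq]
    · have : c * (h ⬝ᵥ q) = -1 := by
        rw [hc, div_mul_eq_mul_div, div_eq_iff h0, hhq, hhh]; ring
      rw [this, hh]; module
  · intro w hpw hqw
    rw [hmul, hh, sub_dotProduct, hpw, hqw]; simp
  · intro P hP a hPp hPq
    have hPh : P *ᵥ h = a • h := by rw [hh, mulVec_sub, hPp, hPq, smul_sub]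
    rw [sub_mul, mul_sub, one_mul, mul_one, smul_mul_assoc, mul_smul_comm, vecMulVec_mul,
      mul_vecMulVec, ← mulVec_transpose, hP, hPh, vecMulVec_smul,
      smul_vecMulVec]

end Rotation

/-! ### The special form and both implications. -/

section IdZero

variable {n m r : ℕ} {A : Fin m → Matrix (Fin n) (Fin n) ℝ} {b : Fin m → ℝ}

theorem dot_single (Y : Matrix (Fin n) (Fin n) ℝ) (i j : Fin n) :
    dot Y (single i j 1) = Y i j := by
  rw [dot, Finset.sum_eq_single i, Finset.sum_eq_single j]
  · simp
  · intro k _ hk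
    simp [hk.symm]
  · simp
  · intro k _ hk
    simp [hk.symm]
  · simp

theorem exists_mul_dotProduct_self_eq_one {x : Fin n → ℝ} (hx : x ≠ 0) :
    ∃ α : ℝ, 0 < α ∧ α * α * (x ⬝ᵥ x) = 1 := by
  have : 0 < x ⬝ᵥ x := lt_of_le_of_ne (Finset.sum_nonneg fun i _ => mul_self_nonneg (x i))
    fun h => hx (dotProduct_self_eq_zero.1 h.symm)
  refine ⟨(√(x ⬝ᵥ x))⁻¹, by positivity, ?_⟩
  rw [← mul_inv, Real.mul_self_sqrt this.le, inv_mul_cancel₀ this.ne']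

theorem idZero_transpose : (idZero n r)ᵀ = idZero n r := diagonal_transpose _

theorem idZero_mul_self : idZero n r * idZero n r = idZero n r := by
  rw [idZero, diagonal_mul_diagonal]
  congr 1
  ext i
  split_ifs <;> simp

theorem idZero_mulVec (x : Fin n → ℝ) (i : Fin n) :
    (idZero n r *ᵥ x) i = if i.val < r then x i else 0 := by
  rw [idZero, mulVec_diagonal]; split_ifs <;> simp

theorem one_sub_idZero :
    1 - idZero n r = diagonal fun i : Fin n => if i.val < r then (0 : ℝ) else 1 := by
  rw [idZero, ← diagonal_one, diagonal_sub]
  congr 1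
  ext i
  split_ifs <;> simp

theorem idZero_conj_apply (V : Matrix (Fin n) (Fin n) ℝ) (i j : Fin n) :
    (idZero n r * V * idZero n r) i j = if i.val < r ∧ j.val < r then V i j else 0 := by
  rw [idZero, mul_diagonal, diagonal_mul]
  by_cases hi : i.val < r <;> by_cases hj : j.val < r <;> simp [hi, hj]

theorem one_sub_idZero_conj_apply (V : Matrix (Fin n) (Fin n) ℝ) (i j : Fin n) :
    ((1 - idZero n r) * V * (1 - idZero n r)) i j
      = if r ≤ i.val ∧ r ≤ j.val then V i j else 0 := by
  rw [one_sub_idZero, mul_diagonal, diagonal_mul]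
  by_cases hi : i.val < r <;> by_cases hj : j.val < r <;> simp [hi, hj, not_le.2, not_lt.1]

/-- Within the K-block, row and column `r` vanish, so its quadratic form is that of V₃₃. -/
theorem HasSpecialForm.posSemidef_conj {V : Matrix (Fin n) (Fin n) ℝ} (h : HasSpecialForm r V) :
    ((1 - idZero n r) * V * (1 - idZero n r)).PosSemidef := by
  obtain ⟨hV, -, hrn, -, h0, hP⟩ := h
  have hentry : ∀ i j, ((1 - idZero n r) * V * (1 - idZero n r)) i j
      = if r < i.val ∧ r < j.val then V i j else 0 := by
    intro i j
    rw [one_sub_idZero_conj_apply]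
    by_cases hi : i.val = r
    · have hi' : i = ⟨r, hrn⟩ := Fin.ext hi
      have : r ≤ j.val → V i j = 0 := fun hj => by rw [← hV.apply, hi']; exact h0 j hj
      simp +contextual [hi, this]
    by_cases hj : j.val = r
    · have hj' : j = ⟨r, hrn⟩ := Fin.ext hj
      have : r ≤ i.val → V i j = 0 := fun hi => by rw [hj']; exact h0 i hi
      simp +contextual [hj, this]
    have h1 : r ≤ i.val ↔ r < i.val := by omega
    have h2 : r ≤ j.val ↔ r < j.val := by omega
    simp only [h1, h2]
  have hsum : ∀ F : Fin n → ℝ, (∑ i, if r < i.val then F i else 0)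
      = ∑ i : {i : Fin n // r < i.val}, F i := by
    intro F
    rw [← Finset.sum_filter]
    exact Finset.sum_subtype _ (by simp) F
  refine posSemidef_iff.2 ⟨?_, fun x => ?_⟩
  · ext i j
    simp only [transpose_apply, hentry, hV.apply i j, and_comm]
  · have := (posSemidef_iff_dotProduct_mulVec.1 hP).2 fun i => x i.val
    simp only [dotProduct, mulVec, submatrix_apply, star_trivial] at this
    refine le_of_le_of_eq this (Eq.symm ?_)
    change ∑ i, x i * ∑ j, _ * x j = _
    rw [← hsum fun i => x i * ∑ j : {i : Fin n // r < i.val}, V i j * x j]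
    refine Finset.sum_congr rfl fun i _ => ?_
    rw [← hsum fun j => V i j * x j]
    simp only [hentry]
    by_cases hi : r < i.val <;> simp [hi]

theorem badlyBehaved_of_hasSpecialForm
    (hJ : IsMaxRankFeasible A b (idZero n r)) {V : Matrix (Fin n) (Fin n) ℝ} {lam : ℝ}
    (hVA : ∀ i, dot (A i) V = lam * b i) (hV : HasSpecialForm r V) : BadlyBehaved A b := by
  intro hwell
  have hP := hV.posSemidef_conj
  obtain ⟨hVs, hr, hrn, h1, -, -⟩ := hV
  set p : Fin n := ⟨0, by omega⟩ with hp
  set q : Fin n := ⟨r, hrn⟩ with hq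
  have hJs : (idZero n r)ᵀ = idZero n r := idZero_transpose
  have hJJ : idZero n r * idZero n r = idZero n r := idZero_mul_self
  set B : Matrix (Fin n) (Fin n) ℝ := -(single p q 1 + single q p 1) with hB
  have hBdot : ∀ Y, dot B Y = -(Y p q + Y q p) := by
    intro Y
    rw [dot_comm, hB, ← dotLin_apply, map_neg, map_add, dotLin_apply, dotLin_apply,
      dot_single, dot_single]
  have hBs : B.IsSymm := by simp [hB, IsSymm, add_comm]
  have hB0 : ∀ Y ∈ feasible A b, dot B Y = 0 := by
    intro Y hY
    rw [hBdot, eq_conj_of_isMaxRankFeasible hJ hJs hJJ hY, idZero_conj_apply, idZero_conj_apply]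
    simp [hq]
  have himg : (fun Y => dot B Y) '' feasible A b = {0} := by
    ext t
    constructor
    · rintro ⟨Y, hY, rfl⟩
      exact hB0 Y hY
    · rintro rfl
      exact ⟨_, hJ.1, hB0 _ hJ.1⟩
  obtain ⟨x, hZ, hx⟩ := hwell B hBs 0 (by rw [himg]; exact isGLB_singleton)
  set Z := B - ∑ i, x i • A i with hZdef
  have hZs : Zᵀ = Z := (posSemidef_iff.1 hZ).1
  -- Complementary slackness at the feasible `idZero n r`; for `Z` ⪰ 0 it annihilates the J-block
  -- and then all of `Z * idZero n r`.
  have hZJ : dot Z (idZero n r) = 0 := by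
    rw [hZdef, dot_sub_left, dot_sum_smul_left, hB0 _ hJ.1]
    simp only [hJ.1.2, mul_comm (x _), hx, sub_zero]
  have hJZJ : idZero n r * Z * idZero n r = 0 := by
    have h2 := posSemidef_conj hZ (idZero n r)
    rw [hJs] at h2
    refine h2.trace_eq_zero_iff.1 ?_
    have h3 := dot_mul_mul (idZero n r) (idZero n r) Z 1
    rwa [hJs, mul_one, hJJ, hZJ, dot_comm, dot_eq_trace, transpose_one, one_mul] at h3
  have hZJ0 : Z * idZero n r = 0 := ext_mulVec fun w => by
    rw [← mulVec_mulVec, zero_mulVec]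
    refine posSemidef_mulVec_eq_zero hZ ?_
    have := dotProduct_conj_mulVec (idZero n r) Z (idZero n r) w w
    rw [hJs, hJZJ, zero_mulVec, dotProduct_zero] at this
    exact this.symm
  have hJZ0 : idZero n r * Z = 0 := by
    have := congrArg transpose hZJ0
    rwa [transpose_mul, hZs, hJs, transpose_zero] at this
  have hZK : (1 - idZero n r) * Z * (1 - idZero n r) = Z := by
    rw [sub_mul, one_mul, hJZ0, sub_zero, mul_sub, mul_one, hZJ0, sub_zero]
  have hpos : 0 ≤ dot Z V := by
    rw [← hZK, dot_mul_mul, one_sub_transpose hJs]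
    exact dot_nonneg hZ hP
  have hpq : V p q = 1 := by simpa [hp] using h1 p hr
  have hqp : V q p = 1 := by rw [hVs.apply, hpq]
  have hsum : ∑ i, x i * (lam * b i) = 0 := by
    have : ∑ i, x i * (lam * b i) = lam * ∑ i, b i * x i := by
      rw [Finset.mul_sum]
      exact Finset.sum_congr rfl fun i _ => by ring
    rw [this, hx, mul_zero]
  rw [hZdef, dot_sub_left, dot_sum_smul_left, hBdot, hpq, hqp] at hpos
  simp only [hVA, hsum] at hpos
  norm_num at hpos

/-- Since `u` lies in ker J and `V *ᵥ u` in the range of J, an orthogonal map commuting with J can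
send the unit vectors of index `r` and `0` to their normalizations. -/
theorem exists_rotate_hasSpecialForm {V : Matrix (Fin n) (Fin n) ℝ} {lam : ℝ} {u : Fin n → ℝ}
    (hV : IsCertificate A b (idZero n r) V lam u) :
    ∃ T : Matrix (Fin n) (Fin n) ℝ, T * Tᵀ = 1 ∧ T * idZero n r = idZero n r * T ∧
      ∃ (V' : Matrix (Fin n) (Fin n) ℝ) (lam' : ℝ),
        (∀ i, dot (rotate T A i) V' = lam' * b i) ∧ HasSpecialForm r V' := by
  have hJs : (idZero n r)ᵀ = idZero n r := idZero_transpose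
  have hJJ : idZero n r * idZero n r = idZero n r := idZero_mul_self
  obtain ⟨hVs, hVA, hVP, hu0, hVu0, hVu⟩ := hV
  set J := idZero n r with hJ
  set p₀ := V *ᵥ u with hp₀
  have hJp₀ : J *ᵥ p₀ = p₀ := by
    rw [sub_mulVec, one_mulVec, sub_eq_zero] at hVu0
    exact hVu0.symm
  rw [hJp₀] at hVu
  have hune : u ≠ 0 := by
    rintro rfl
    exact hVu (by rw [hp₀, mulVec_zero])
  have hui : ∀ i : Fin n, i.val < r → u i = 0 := fun i hi => by
    have := congrFun hu0 i
    rwa [hJ, idZero_mulVec, if_pos hi] at this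
  have hpi : ∀ i : Fin n, r ≤ i.val → p₀ i = 0 := fun i hi => by
    have := congrFun hJp₀ i
    rw [hJ, idZero_mulVec, if_neg (not_lt.2 hi)] at this
    exact this.symm
  obtain ⟨i, hi⟩ := Function.ne_iff.1 hune
  obtain ⟨j, hj⟩ := Function.ne_iff.1 hVu
  have hir : r ≤ i.val := by
    by_contra! h
    exact hi (hui i h)
  have hjr : j.val < r := by
    by_contra! h
    exact hj (hpi j h)
  have hrn : r < n := lt_of_le_of_lt hir i.2
  have hr0 : 0 < r := lt_of_le_of_lt (Nat.zero_le _) hjr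
  set i₀ : Fin n := ⟨0, by omega⟩ with hi₀
  set i₁ : Fin n := ⟨r, hrn⟩ with hi₁
  obtain ⟨α, hα0, hα⟩ := exists_mul_dotProduct_self_eq_one hune
  obtain ⟨γ, hγ0, hγ⟩ := exists_mul_dotProduct_self_eq_one hVu
  set e₀ : Fin n → ℝ := Pi.single i₀ 1 with he₀
  set e₁ : Fin n → ℝ := Pi.single i₁ 1 with he₁
  have hJe₀ : J *ᵥ e₀ = e₀ := by
    ext k
    rw [hJ, idZero_mulVec, he₀]
    by_cases hk : k = i₀
    · simp [hk, hi₀, hr0]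
    · simp [hk]
  have hJe₁ : J *ᵥ e₁ = 0 := by
    ext k
    rw [hJ, idZero_mulVec, he₁]
    by_cases hk : k = i₁
    · simp [hk, hi₁]
    · simp [hk]
  obtain ⟨H, hHs, hHH, hHe, hHw, hHJ⟩ := exists_householder (p := γ • p₀) (q := e₀)
    (by simpa [← mul_assoc] using hγ) (by simp [he₀])
  obtain ⟨G, hGs, hGG, hGe, hGw, hGJ⟩ := exists_householder (p := α • u) (q := e₁)
    (by simpa [← mul_assoc] using hα) (by simp [he₁])
  have horth : ∀ x y : Fin n → ℝ, J *ᵥ x = x → J *ᵥ y = 0 → x ⬝ᵥ y = 0 := by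
    intro x y hx hy
    rw [← hx, dotProduct_comm, dotProduct_mulVec, ← mulVec_transpose, hJs, hy, zero_dotProduct]
  have hJγ : J *ᵥ (γ • p₀) = γ • p₀ := by rw [mulVec_smul, hJp₀]
  have hJα : J *ᵥ (α • u) = 0 := by rw [mulVec_smul, hu0, smul_zero]
  have hHcomm : H * J = J * H := hHJ J hJs 1 (by rw [hJγ, one_smul]) (by rw [hJe₀, one_smul])
  have hGcomm : G * J = J * G := hGJ J hJs 0 (by rw [hJα, zero_smul]) (by rw [hJe₁, zero_smul])
  have hTt : (H * G)ᵀ = G * H := by rw [transpose_mul, hHs, hGs]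
  have hTT : (H * G) * (H * G)ᵀ = 1 := by
    rw [hTt, mul_assoc, ← mul_assoc G, hGG, one_mul, hHH]
  have hTJ : H * G * J = J * (H * G) := by
    rw [mul_assoc, hGcomm, ← mul_assoc, hHcomm, mul_assoc]
  have hHu : H *ᵥ (α • u) = α • u :=
    hHw _ (horth _ _ hJγ hJα) (horth _ _ hJe₀ hJα)
  have hGe₀ : G *ᵥ e₀ = e₀ :=
    hGw _ (by rw [dotProduct_comm]; exact horth _ _ hJe₀ hJα)
      (by rw [dotProduct_comm]; exact horth _ _ hJe₀ hJe₁)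
  have hHp : H *ᵥ (γ • p₀) = e₀ := by
    rw [← hHe, mulVec_mulVec, hHH, one_mulVec]
  -- The factor γ/α makes column `r` exactly `e₀`; being positive, it preserves semidefiniteness of
  -- the K-block.
  set V' : Matrix (Fin n) (Fin n) ℝ := (γ * α⁻¹) • ((H * G)ᵀ * V * (H * G)) with hV'
  have hcol : V' *ᵥ e₁ = e₀ := by
    have h1 : (H * G) *ᵥ e₁ = α • u := by rw [← mulVec_mulVec, hGe, hHu]
    have h2 : V *ᵥ (α • u) = (α * γ⁻¹) • (γ • p₀) := by
      rw [mulVec_smul, ← hp₀, smul_smul, mul_assoc, inv_mul_cancel₀ hγ0.ne', mul_one]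
    rw [hV', smul_mulVec, ← mulVec_mulVec, ← mulVec_mulVec, h1, h2, mulVec_smul, hTt,
      ← mulVec_mulVec, hHp, hGe₀, smul_smul]
    have : γ * α⁻¹ * (α * γ⁻¹) = 1 := by field_simp
    rw [this, one_smul]
  have hcol' : ∀ k, V' k i₁ = e₀ k := fun k => by rw [← hcol]; simp [he₁]
  refine ⟨H * G, hTT, hTJ, V', γ * α⁻¹ * lam, fun k => ?_, ?_, hr0, hrn, fun k _ => ?_,
    fun k hk => ?_, ?_⟩
  · have : H * G * ((H * G)ᵀ * V * (H * G)) * (H * G)ᵀ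
        = ((H * G) * (H * G)ᵀ) * V * ((H * G) * (H * G)ᵀ) := by simp only [mul_assoc]
    rw [hV', dot_smul_right, dot_rotate, this, hTT, one_mul, mul_one, hVA,
      ← mul_assoc]
  · simp only [IsSymm, hV', transpose_smul, transpose_mul, transpose_transpose, hVs.eq, mul_assoc]
  · rw [hcol', he₀, Pi.single_apply]
    simp [Fin.ext_iff, hi₀]
  · rw [hcol', he₀, Pi.single_apply, if_neg]
    rw [Fin.ext_iff]
    exact (lt_of_lt_of_le hr0 hk).ne'
  · have hK : (1 - J) * V' * (1 - J)
        = (γ * α⁻¹) • ((H * G)ᵀ * ((1 - J) * V * (1 - J)) * (H * G)) := by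
      have h1 : (H * G) * (1 - J) = (1 - J) * (H * G) := by
        rw [mul_sub, sub_mul, hTJ, mul_one, one_mul]
      have h2 : (1 - J) * (H * G)ᵀ = (H * G)ᵀ * (1 - J) := by
        have := congrArg transpose h1
        rwa [transpose_mul _ (1 - J), transpose_mul (1 - J), one_sub_transpose hJs] at this
      rw [hV', mul_smul_comm, smul_mul_assoc, mul_assoc (1 - J), mul_assoc _ (H * G), h1,
        ← mul_assoc (1 - J), ← mul_assoc (1 - J), h2]
      simp only [mul_assoc]
    have hpsd : ((1 - J) * V' * (1 - J)).PosSemidef := by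
      rw [hK]
      exact (posSemidef_conj' hVP _).smul (by positivity)
    convert hpsd.submatrix (fun i : {i : Fin n // r < i.val} => i.val) using 1
    ext a c
    rw [submatrix_apply, submatrix_apply, hJ, one_sub_idZero_conj_apply,
      if_pos ⟨a.2.le, c.2.le⟩]

end IdZero

end DualSDP

theorem theorem5p3 (n m r : ℕ) (hr : r ≤ n)
    (A : Fin m → Matrix (Fin n) (Fin n) ℝ) (hA : ∀ i, (A i).IsSymm) (b : Fin m → ℝ)
    (hY : DualSDP.IsMaxRankFeasible A b (DualSDP.idZero n r)) :
    DualSDP.BadlyBehaved A b ↔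
      ∃ T : Matrix (Fin n) (Fin n) ℝ, IsUnit T ∧
        DualSDP.IsMaxRankFeasible (DualSDP.rotate T A) b (DualSDP.idZero n r) ∧
        ∃ (V : Matrix (Fin n) (Fin n) ℝ) (lam : ℝ),
          (∀ i, DualSDP.dot (DualSDP.rotate T A i) V = lam * b i) ∧
          DualSDP.HasSpecialForm r V := by
  constructor
  · intro hbad
    have hcert : ∃ V lam u, DualSDP.IsCertificate A b (DualSDP.idZero n r) V lam u := by
      by_contra! hno
      exact hbad (DualSDP.wellBehaved_of_forall_not_isCertificate hY DualSDP.idZero_transpose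
        DualSDP.idZero_mul_self hA hno)
    obtain ⟨V, lam, u, hV⟩ := hcert
    obtain ⟨T, hTT, hTJ, hV'⟩ := DualSDP.exists_rotate_hasSpecialForm hV
    exact ⟨T, ⟨⟨T, T.transpose, hTT, mul_eq_one_comm.1 hTT⟩, rfl⟩,
      DualSDP.isMaxRankFeasible_rotate hTT hTJ hY, hV'⟩
  · rintro ⟨T, hT, hmax, V, lam, hVA, hV⟩ hwell
    exact DualSDP.badlyBehaved_of_hasSpecialForm hmax hVA hV
      (hwell.rotate hT)
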